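/- A Petri net with hierarchical transfer arcs is a tuple $(P,T,F,\sqsubseteq,M_0)$ where $P$ is a finite set of places, $T$ a finite set of transitions, $\sqsubseteq$ a total order on $P$, $M_0:P\to\mathbb N$ the initial marking, and $F$ a flow relation with $F(t,p)\in\mathbb N$ and $F(p,t)\in\mathbb N\cup\{S_{q}\mid q\in P\}$ for all $p\in P$, $t\in T$, such that whenever $F(p,t)\notin\mathbb N$, also $F(q,t)\notin\mathbb N$ for every $q\sqsubseteq p$. Here $F(p,t)=S_q$ means that there is a transfer arc from $p$ through $t$ to $q$. A transition $t$ is firable at a marking $M:P\to\mathbb N$ if $M(p)\ge F(p,t)$ for all $p$ with $F(p,t)\in\mathbb N$; firing it gives the marking $M'$ with $$M'(p)=r(p)+\sum_{q\,:\,F(q,t)=S_p}M(q)+F(t,p),$$ where $r(p)=M(p)-F(p,t)$ if $F(p,t)\in\mathbb N$ and $r(p)=0$ otherwise. A marking is reachable if it is obtained from $M_0$ by firing finitely many (possibly zero) transitions. Theorem. For Petri nets with hierarchical transfer arcs, given as finite data, the following two problems are undecidable: (1) Reachability: given a net and a marking $M$, is $M$ reachable? (2) Deadlock-freeness: given a net,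 is there a reachable marking at which no transition is firable? -/

import Mathlib

namespace PetriNets

/-- The label `F(p, t)` of a place-transition pair: an ordinary arc with a weight in `ℕ` (weight `0`
means that there is no arc), an inhibitor arc `I`, a reset arc `R`, or a transfer arc `S_q` that
moves the tokens to the place `q`. -/
inductive Arc (P : Type) where
  | weight (w : ℕ) : Arc P
  | inhibitor : Arc P
  | reset : Arc P
  | transfer (q : P) : Arc P

/-- The label is an element of `ℕ`. -/
def Arc.IsNat {P : Type} (a : Arc P) : Prop := ∃ w, a = Arc.weight w

/-- The label is of the form `S_q`. -/
def Arc.IsTransfer {P : Type} (a : Arc P) : Prop := ∃ q, a = Arc.transfer q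

/-- A marking assigns a number of tokens to every place. -/
abbrev Marking (P : Type) : Type := P → ℕ

/-- A Petri net with hierarchical special arcs `(P, T, F, ⊑, M₀)`. The flow relation `F` is given by
its restriction `pre` to `P × T` and its restriction `post` to `T × P`, the latter with values in
`ℕ`. -/
structure HierarchicalNet (P T : Type) where
  pre : P → T → Arc P
  post : T → P → ℕ
  /-- the hierarchy `⊑` -/
  hle : P → P → Prop
  hle_linear : IsLinearOrder P hle
  init : Marking P
  hierarchical : ∀ p t, ¬ (pre p t).IsNat → ∀ q, hle q p → ¬ (pre q t).IsNat

namespace HierarchicalNet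

variable {P T : Type}

/-- What an arc with label `a` demands of the number `k` of tokens in its place. -/
def Enables (a : Arc P) (k : ℕ) : Prop :=
  match a with
  | Arc.weight w => w ≤ k
  | Arc.inhibitor => k = 0
  | Arc.reset => True
  | Arc.transfer _ => True

/-- The number of tokens, out of `k`, that an arc with label `a` leaves in its place. -/
def remaining (a : Arc P) (k : ℕ) : ℕ :=
  match a with
  | Arc.weight w => k - w
  | Arc.inhibitor => k
  | Arc.reset => 0
  | Arc.transfer _ => 0

/-- Transition `t` is firable at the marking `M`. -/
def Firable (N : HierarchicalNet P T) (M : Marking P) (t : T) : Prop :=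
  ∀ p, Enables (N.pre p t) (M p)

open Classical in
/-- The marking after firing `t` at `M`: tokens are removed from the pre-places, the transfer arcs
of `t` simultaneously move the contents (at `M`) of their sources to their targets, and the tokens
of the post-arcs are added. -/
noncomputable def fire [Fintype P] (N : HierarchicalNet P T) (M : Marking P) (t : T) : Marking P :=
  fun p => remaining (N.pre p t) (M p)
    + (∑ q : P, if N.pre q t = Arc.transfer p then M q else 0) + N.post t p

/-- `M₁ → M₂` by firing some transition. -/
def Step [Fintype P] (N : HierarchicalNet P T) (M₁ M₂ : Marking P) : Prop :=
  ∃ t, N.Firable M₁ t ∧ M₂ = N.fire M₁ t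

/-- There is a (finite, possibly empty) run from the initial marking to `M`. -/
def Reachable [Fintype P] (N : HierarchicalNet P T) (M : Marking P) : Prop :=
  Relation.ReflTransGen N.Step N.init M

/-- No transition is firable at `M`. -/
def Deadlocked (N : HierarchicalNet P T) (M : Marking P) : Prop :=
  ∀ t, ¬ N.Firable M t

/-- Some reachable marking is deadlocked: the question asked by the problem `DLFree`. -/
def HasReachableDeadlock [Fintype P] (N : HierarchicalNet P T) : Prop :=
  ∃ M, N.Reachable M ∧ N.Deadlocked M

/-- All special arcs are transfer arcs. -/
def TransferOnly (N : HierarchicalNet P T) : Prop :=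
  ∀ p t, ¬ (N.pre p t).IsNat → (N.pre p t).IsTransfer

end HierarchicalNet

/-- A finite Petri net with hierarchical transfer arcs, its places and its transitions being
numbered. -/
structure HTPN where
  places : ℕ
  transitions : ℕ
  net : HierarchicalNet (Fin places) (Fin transitions)
  transferOnly : net.TransferOnly

/-- An input of the reachability problem: a net and a target marking. -/
structure ReachInput where
  htpn : HTPN
  target : Marking (Fin htpn.places)

/-! ### Inputs as finite data: every net is written down as a list of tables -/

/-- A matrix, row by row. -/
def table {m n : ℕ} {α : Type} (A : Fin m → Fin n → α) : List (List α) :=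
  List.ofFn fun i => List.ofFn fun j => A i j

/-- A label, as a pair (kind, number). -/
def Arc.code {n : ℕ} (a : Arc (Fin n)) : ℕ × ℕ :=
  match a with
  | Arc.weight w => (0, w)
  | Arc.inhibitor => (1, 0)
  | Arc.reset => (2, 0)
  | Arc.transfer q => (3, (q : ℕ))

/-- Numbers of places and of transitions, table of `F` on `P × T`, table of `F` on `T × P`,
truth table of the hierarchy, initial marking. -/
abbrev NetCode : Type :=
  ℕ × ℕ × List (List (ℕ × ℕ)) × List (List ℕ) × List (List Bool) × List ℕ

open Classical in
/-- The description of a net as finite data. -/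
noncomputable def HTPN.code (N : HTPN) : NetCode :=
  (N.places, N.transitions, table fun p t => (N.net.pre p t).code, table N.net.post,
    table fun p q => decide (N.net.hle p q), List.ofFn N.net.init)

/-- The description of an input of the reachability problem as finite data. -/
noncomputable def ReachInput.code (x : ReachInput) : NetCode × List ℕ :=
  (x.htpn.code, List.ofFn x.target)

/-- The decision problem `p` on inputs from `α`, written down by `code`, is decidable: some algorithm
(partial recursive function) halts on the description of every input with the right answer. -/
def AlgorithmicallyDecidable {α C : Type} [Primcodable C] (code : α → C) (p : α → Prop) : Prop :=
  ∃ f : C →. Bool, Partrec f ∧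
    ∀ x, (p x → true ∈ f (code x)) ∧ (¬ p x → false ∈ f (code x))

/-! ### The descriptions determine the inputs -/

theorem table_injective {m n : ℕ} {α : Type} :
    Function.Injective (table : (Fin m → Fin n → α) → List (List α)) := by
  intro A B h
  have h1 := List.ofFn_injective h
  funext i
  exact List.ofFn_injective (congrFun h1 i)

theorem Arc.code_injective {n : ℕ} : Function.Injective (Arc.code : Arc (Fin n) → ℕ × ℕ) := by
  intro a b h
  cases a <;> cases b <;> simp_all [Arc.code, Fin.ext_iff]

theorem HTPN.code_injective : Function.Injective HTPN.code := by
  rintro ⟨n, m, ⟨pre, post, hle, h1, init, h2⟩, h3⟩ ⟨n', m', ⟨pre', post', hle', h1', init', h2'⟩, h3'⟩ h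
  simp only [HTPN.code, Prod.mk.injEq] at h
  obtain ⟨rfl, rfl, ha, hb, hc, hd⟩ := h
  have ea : pre = pre' := by
    funext p t
    exact Arc.code_injective (congrFun (congrFun (table_injective ha) p) t)
  have eb := table_injective hb
  have ec : hle = hle' := by
    funext p q
    simpa using congrFun (congrFun (table_injective hc) p) q
  have ed := List.ofFn_injective hd
  subst ea eb ec ed
  rfl

theorem ReachInput.code_injective : Function.Injective ReachInput.code := by
  rintro ⟨N, M⟩ ⟨N', M'⟩ h
  simp only [ReachInput.code, Prod.mk.injEq] at h
  obtain ⟨hN, hM⟩ := h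
  obtain rfl := HTPN.code_injective hN
  rw [List.ofFn_injective hM]

end PetriNets

/-!
The halting problem of counter machines reduces to both problems, with one net for both.

Primitive recursive functions are computed by structured counter programs (`computes_of_primrec`),
so a primitive recursive test followed by an unbounded search (`exists_search`) gives one fixed
program that, run on an input `n`, terminates if and only if the `n`-th partial recursive function
is defined at `0`. A program is the same as a counter machine whose control states are the positions of
the program (`halts_machine_iff`), which yields a machine with an undecidable halting problem
(`exists_undecidable_machine`).

A net cannot test a counter for zero, but a transfer arc can punish a wrong guess: a transition that
guesses that a register is zero moves the contents of that register to the place `trash`, which is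
never emptied. A run that ends with an empty `trash` has therefore guessed right throughout and is a
faithful simulation (`Invariant.step`). The hierarchy demands that every place below the source of a
special arc of a transition has such an arc as well. So each register is spread over two places,
and a zero test of one register makes the two places of every other register exchange their
contents, which leaves the represented number unchanged. The places other than the counters stand
above them in the hierarchy and are free of special arcs.

When the machine has halted, the remaining tokens on the counters can be removed. A nonempty `trash`
keeps an idle transition firable, and every control state other than the final one has a firable
zero test. Hence the only control state with deadlocks is the final one, deadlocks require that `trash`
is empty, and the marking with a single token, in the final control state, is a deadlock. The machine
halts if and only if that marking is reachable (`reachable_final_iff`), and if and only if some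
deadlock is reachable (`hasReachableDeadlock_iff`).

The input of the machine only enters the initial marking of the net, so that the description of the
net is a computable function of it (`exists_computable_family`).
-/

open Function

/-! ### Counter programs and primitive recursive functions -/

namespace PetriNets

/-- Structured programs over registers numbered by `ℕ`, each holding a natural number. The loop
`loop r p` means: while register `r` is nonzero, decrement it and run `p`. -/
inductive CounterProgram where
  | inc (r : ℕ)
  /-- decrement, leaving the value `0` unchanged -/
  | dec (r : ℕ)
  | seq (p q : CounterProgram)
  | loop (r : ℕ) (p : CounterProgram)

namespace CounterProgram

/-- `Eval p v v'`: run from the register contents `v`, the program `p` terminates with the register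
contents `v'`. -/
inductive Eval : CounterProgram → (ℕ → ℕ) → (ℕ → ℕ) → Prop
  | inc (r v) : Eval (inc r) v (update v r (v r + 1))
  | dec (r v) : Eval (dec r) v (update v r (v r - 1))
  | seq {p q v₁ v₂ v₃} : Eval p v₁ v₂ → Eval q v₂ v₃ → Eval (seq p q) v₁ v₃
  | loop_zero {r p v} : v r = 0 → Eval (loop r p) v v
  | loop_succ {r p v₁ v₂ v₃} : v₁ r ≠ 0 → Eval p (update v₁ r (v₁ r - 1)) v₂ →
      Eval (loop r p) v₂ v₃ → Eval (loop r p) v₁ v₃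

theorem Eval.congr {p : CounterProgram} {v v₁ v₂ : ℕ → ℕ} (h : Eval p v v₁) (e : v₁ = v₂) :
    Eval p v v₂ := e ▸ h

theorem Eval.deterministic {p : CounterProgram} {v v₁ v₂ : ℕ → ℕ} (h₁ : Eval p v v₁)
    (h₂ : Eval p v v₂) : v₁ = v₂ := by
  induction h₁ generalizing v₂ with
  | inc r v => cases h₂; rfl
  | dec r v => cases h₂; rfl
  | seq _ _ ihp ihq =>
    cases h₂ with
    | seq hp hq => rw [← ihp hp] at hq; exact ihq hq
  | loop_zero h =>
    cases h₂ with
    | loop_zero => rfl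
    | loop_succ h' => exact absurd h h'
  | loop_succ h _ _ ihp ihl =>
    cases h₂ with
    | loop_zero h' => exact absurd h' h
    | loop_succ _ hp hl => rw [← ihp hp] at hl; exact ihl hl

/-- The rule for counting loops: `s k` is the state in which `k` rounds remain. -/
theorem eval_loop {r : ℕ} {p : CounterProgram} (s : ℕ → ℕ → ℕ) (hs : ∀ k, s k r = k) (n : ℕ)
    (h : ∀ k < n, Eval p (update (s (k + 1)) r k) (s k)) : Eval (loop r p) (s n) (s 0) := by
  induction n with
  | zero => exact .loop_zero (hs 0)
  | succ n ih =>
    refine .loop_succ (by rw [hs]; omega) ?_ (ih fun k hk => h k (by omega))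
    rw [hs]
    exact h n (by omega)

/-- Set register `r` to zero. -/
def clear (r : ℕ) : CounterProgram := loop r (dec r)

theorem eval_clear (r : ℕ) (v : ℕ → ℕ) : Eval (clear r) v (update v r 0) := by
  induction hn : v r using Nat.strong_induction_on generalizing v with
  | _ n ih =>
    by_cases h : v r = 0
    · exact (Eval.loop_zero h).congr (by rw [← h, update_eq_self])
    · refine .loop_succ h (.dec _ _) ((ih _ ?_ _ rfl).congr ?_)
      · simp only [update_self]; omega
      · simp

/-- Add register `r` to register `s` and set `r` to zero. -/
def move (r s : ℕ) : CounterProgram := loop r (inc s)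

theorem eval_move {r s : ℕ} (hrs : r ≠ s) (v : ℕ → ℕ) :
    Eval (move r s) v (update (update v r 0) s (v s + v r)) := by
  have := eval_loop (r := r) (p := inc s)
    (fun k => update (update v r k) s (v s + (v r - k))) (by grind) (v r) (fun k hk =>
      (Eval.inc _ _).congr (by grind))
  have h : update (update v r (v r)) s (v s + (v r - v r)) = v := by simp
  rw [h] at this
  exact this

/-- Add register `r` to register `s`, with the help of a register `t` that holds zero. -/
def copy (r s t : ℕ) : CounterProgram := seq (loop r (seq (inc s) (inc t))) (move t r)

theorem eval_copy {r s t : ℕ} (hrs : r ≠ s) (hrt : r ≠ t) (hst : s ≠ t) (v : ℕ → ℕ)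
    (ht : v t = 0) : Eval (copy r s t) v (update v s (v s + v r)) := by
  have := eval_loop (r := r) (p := seq (inc s) (inc t))
    (fun k => update (update (update v r k) s (v s + (v r - k))) t (v r - k)) (by grind) (v r)
    (fun k hk => .seq (.inc _ _) ((Eval.inc _ _).congr (by grind)))
  have h : update (update (update v r (v r)) s (v s + (v r - v r))) t (v r - v r) = v := by grind
  rw [h] at this
  exact .seq this ((eval_move hrt.symm _).congr (by grind))

/-- Registers `b, …, b + n - 1` are set to `y 0, …, y (n - 1)`. -/
def fill (v : ℕ → ℕ) (b n : ℕ) (y : ℕ → ℕ) : ℕ → ℕ :=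
  fun r => if b ≤ r ∧ r < b + n then y (r - b) else v r

theorem update_fill (v : ℕ → ℕ) (b n : ℕ) (y : ℕ → ℕ) :
    update (fill v b n y) (b + n) (y n) = fill v b (n + 1) y := by
  funext r
  simp only [update_apply, fill]
  grind

theorem exists_eval_clear_block (b n : ℕ) :
    ∃ p, ∀ v, Eval p v (fill v b n fun _ => 0) := by
  induction n with
  | zero =>
    -- a program without any effect
    refine ⟨seq (inc b) (dec b), fun v => .seq (.inc _ _) ((Eval.dec _ _).congr ?_)⟩
    funext r
    simp only [fill, update_apply]
    grind
  | succ n ih =>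
    obtain ⟨p, hp⟩ := ih
    exact ⟨seq p (clear (b + n)), fun v => .seq (hp v)
      ((eval_clear _ _).congr (update_fill v b n fun _ => 0))⟩

/-- The function `f` is computed by counter programs: for all input registers `ins` and all `w`
above them, some program stores the value of `f` in register `w` and leaves all the other registers
as they were, provided that the registers from `w` on hold zero at the start. -/
def Computes {n : ℕ} (f : List.Vector ℕ n → ℕ) : Prop :=
  ∀ (w : ℕ) (ins : Fin n → ℕ), (∀ i, ins i < w) → ∃ p, ∀ v : ℕ → ℕ, (∀ r, w ≤ r → v r = 0) →
    Eval p v (update v w (f (List.Vector.ofFn fun i => v (ins i))))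

/-- The functions `g 0, …, g (n - 1)` are evaluated one after the other, each leaving its value
above the values found before. -/
theorem exists_eval_fill {m : ℕ} (g : ℕ → List.Vector ℕ m → ℕ) (w : ℕ) (ins : Fin m → ℕ)
    (hins : ∀ i, ins i < w) (n : ℕ) (hg : ∀ i < n, Computes (g i)) :
    ∃ p, ∀ v : ℕ → ℕ, (∀ r, w ≤ r → v r = 0) →
      Eval p v (fill v w n fun i => g i (List.Vector.ofFn fun i => v (ins i))) := by
  induction n with
  | zero =>
    refine ⟨dec w, fun v hv => (Eval.dec _ _).congr ?_⟩
    funext r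
    simp only [fill, update_apply]
    grind
  | succ n ih =>
    obtain ⟨p, hp⟩ := ih fun i hi => hg i (by omega)
    obtain ⟨q, hq⟩ := hg n (by omega) (w + n) ins fun i => by have := hins i; omega
    refine ⟨seq p q, fun v hv => .seq (hp v hv) ((hq _ ?_).congr ?_)⟩
    · intro r hr
      simp only [fill]
      grind
    · rw [← update_fill]
      congr
      funext i
      have := hins i
      simp only [fill]
      grind

theorem computes_zero : Computes (n := 0) fun _ => 0 := fun w _ _ =>
  ⟨dec w, fun v hv => (Eval.dec _ _).congr (by rw [hv w le_rfl])⟩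

theorem computes_get {n : ℕ} (i : Fin n) : Computes fun v => v.get i := fun w ins hins => by
  have := hins i
  refine ⟨copy (ins i) w (w + 1), fun v hv => (eval_copy (by omega) (by omega) (by omega) v
    (hv _ (by omega))).congr ?_⟩
  simp only [hv w le_rfl, List.Vector.get_ofFn, zero_add]

theorem computes_succ : Computes (n := 1) fun v => Nat.succ v.head := fun w ins hins => by
  obtain ⟨p, hp⟩ := computes_get (0 : Fin 1) w ins hins
  refine ⟨seq p (inc w), fun v hv => .seq (hp v hv) ((Eval.inc _ _).congr ?_)⟩
  simp [← List.Vector.get_zero]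

theorem Computes.comp {m n : ℕ} {f : List.Vector ℕ n → ℕ} {g : Fin n → List.Vector ℕ m → ℕ}
    (hf : Computes f) (hg : ∀ i, Computes (g i)) :
    Computes fun a => f (List.Vector.ofFn fun i => g i a) := fun w ins hins => by
  obtain ⟨p, hp⟩ := exists_eval_fill (fun i => if h : i < n then g ⟨i, h⟩ else fun _ => 0)
    (w + 1) ins (fun i => by have := hins i; omega) n
    (fun i hi => by simpa only [hi, dif_pos] using hg ⟨i, hi⟩)
  obtain ⟨q, hq⟩ := hf (w + 1 + n) (fun i => w + 1 + i) (fun i => by omega)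
  obtain ⟨c, hc⟩ := exists_eval_clear_block (w + 1) n
  -- the block of intermediate values starts at `w + 1`, to keep the source and the target of the
  -- final `move` distinct when `n = 0`
  refine ⟨seq p (seq q (seq (move (w + 1 + n) w) c)), fun v hv =>
    .seq (hp v fun r hr => hv r (by omega)) <| .seq (hq _ ?_) <|
      .seq (eval_move (by omega) _) <| (hc _).congr ?_⟩
  · intro r hr
    simp only [fill]
    grind
  · have key : (List.Vector.ofFn fun i : Fin n => fill v (w + 1) n (fun i =>
        (if h : i < n then g ⟨i, h⟩ else fun _ => 0) (List.Vector.ofFn fun i => v (ins i)))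
          (w + 1 + i)) = List.Vector.ofFn fun i => g i (List.Vector.ofFn fun i => v (ins i)) := by
      congr 1
      funext i
      simp [fill]
    rw [key]
    dsimp only
    generalize f (List.Vector.ofFn fun i => g i _) = y
    funext r
    simp only [fill, update_apply]
    have := hv r
    have := hv w
    grind

theorem Computes.prec {n : ℕ} {f : List.Vector ℕ n → ℕ} {g : List.Vector ℕ (n + 2) → ℕ}
    (hf : Computes f) (hg : Computes g) :
    Computes fun v : List.Vector ℕ (n + 1) =>
      v.head.rec (f v.tail) fun y IH => g (y ::ᵥ IH ::ᵥ v.tail) := fun w ins hins => by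
  have h0 := hins 0
  obtain ⟨p, hp⟩ := hf w (fun i => ins i.succ) (fun i => hins _)
  obtain ⟨q, hq⟩ := hg (w + 3) (Fin.cons (w + 1) (Fin.cons w fun i => ins i.succ)) (by
    intro i
    refine Fin.cases ?_ (fun i => Fin.cases ?_ (fun i => ?_) i) i
    · simp
    · simp
    · have := hins i.succ
      simp only [Fin.cons_succ]
      omega)
  -- register `w` holds the current value, `w + 1` the number of rounds done, `w + 2` the number
  -- of rounds to come
  refine ⟨seq p (seq (copy (ins 0) (w + 2) (w + 3)) (seq
    (loop (w + 2) (seq q (seq (clear w) (seq (move (w + 3) w) (inc (w + 1)))))) (clear (w + 1)))),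
    fun v hv => ?_⟩
  set a := List.Vector.ofFn fun i => v (ins i.succ) with ha
  have e : (List.Vector.ofFn fun i => v (ins i)) = v (ins 0) ::ᵥ a := rfl
  simp only [e, List.Vector.head_cons, List.Vector.tail_cons]
  set R : ℕ → ℕ := fun k => Nat.rec (f a) (fun y IH => g (y ::ᵥ IH ::ᵥ a)) k with hR
  have hv1 := hv (w + 1) (by omega)
  have hv2 := hv (w + 2) (by omega)
  have hv3 := hv (w + 3) (by omega)
  set N := v (ins 0) with hN
  have hloop := eval_loop (r := w + 2)
    (p := seq q (seq (clear w) (seq (move (w + 3) w) (inc (w + 1)))))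
    (fun k => update (update (update v w (R (N - k))) (w + 1) (N - k)) (w + 2) k) (by simp) N (by
      intro k hk
      refine .seq (hq _ ?_) (.seq (eval_clear _ _) (.seq (eval_move (by omega) _)
        ((Eval.inc _ _).congr ?_)))
      · intro r hr
        have := hv r
        grind
      · have hk' : N - k = N - (k + 1) + 1 := by omega
        have key : (List.Vector.ofFn fun i => update (update (update (update v w (R (N - (k + 1))))
            (w + 1) (N - (k + 1))) (w + 2) (k + 1)) (w + 2) k
            ((Fin.cons (w + 1) (Fin.cons w fun i => ins i.succ) : Fin (n + 2) → ℕ) i)) =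
            (N - (k + 1)) ::ᵥ R (N - (k + 1)) ::ᵥ a := by
          rw [List.Vector.ofFn, List.Vector.ofFn]
          simp only [Fin.cons_zero, Fin.cons_succ]
          congr 1
          · simp
          congr 1
          · simp
          rw [ha]
          congr 1
          funext i
          have := hins i.succ
          grind
        rw [key]
        have hRs : R (N - k) = g ((N - (k + 1)) ::ᵥ R (N - (k + 1)) ::ᵥ a) := by
          rw [hk']
        rw [hRs, hk']
        generalize g _ = y
        generalize R _ = z
        funext r
        simp only [update_apply]
        grind)
  refine .seq (hp v hv) (.seq ((eval_copy (by omega) (by omega) (by omega) _ ?_).congr ?_)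
    (.seq hloop ((eval_clear _ _).congr ?_)))
  · simp only [update_apply]
    grind
  · have : R (N - N) = f a := by simp [hR]
    rw [this, ← ha]
    generalize f a = y
    funext r
    simp only [update_apply]
    grind
  · simp only [Nat.sub_zero]
    change _ = update v w (R N)
    generalize R N = y
    funext r
    simp only [update_apply]
    grind

theorem computes_of_primrec {n : ℕ} {f : List.Vector ℕ n → ℕ} (hf : Nat.Primrec' f) :
    Computes f := by
  induction hf with
  | zero => exact computes_zero
  | succ => exact computes_succ
  | get i => exact computes_get i
  | comp g _ _ ihf ihg => exact ihf.comp ihg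
  | prec _ _ ihf ihg => exact ihf.prec ihg

/-- Unbounded search: some program, run on the input `n` in register `0`, terminates if and only
if the primitive recursive function `f` has a zero of the form `(m, n)`. -/
theorem exists_search {f : List.Vector ℕ 2 → ℕ} (hf : Nat.Primrec' f) :
    ∃ p, ∀ n, (∃ v', Eval p (Pi.single 0 n) v') ↔ ∃ m, f (m ::ᵥ n ::ᵥ List.Vector.nil) = 0 := by
  obtain ⟨q, hq⟩ := computes_of_primrec hf 2 ![1, 0] (by simp)
  refine ⟨seq q (loop 2 (seq (clear 2) (seq (inc 1) q))), fun n => ?_⟩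
  -- register `1` holds the current candidate `m`, register `2` the value of `f` at `(m, n)`
  let F : ℕ → ℕ := fun m => f (m ::ᵥ n ::ᵥ List.Vector.nil)
  let s : ℕ → ℕ → ℕ := fun m => update (Pi.single 0 n) 1 m
  have hs : ∀ m, Eval q (s m) (update (s m) 2 (F m)) := fun m =>
    (hq (s m) (fun r hr => by simp only [s, update_apply, Pi.single_apply]; grind)).congr rfl
  have hround : ∀ m k, Eval (seq (clear 2) (seq (inc 1) q)) (update (s m) 2 k)
      (update (s (m + 1)) 2 (F (m + 1))) := by
    intro m k
    refine .seq (eval_clear _ _) (.seq (Eval.inc _ _) ?_)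
    convert hs (m + 1) using 1
    funext r
    simp only [s, update_apply, Pi.single_apply]
    grind
  have hstart : Eval q (Pi.single 0 n) (update (s 0) 2 (F 0)) := by
    convert hs 0 using 1
    funext r
    simp only [s, update_apply, Pi.single_apply]
    grind
  constructor
  · rintro ⟨v', h⟩
    cases h with
    | seq h₁ h₂ =>
      rw [← hstart.deterministic h₁] at h₂
      generalize hl : loop 2 (seq (clear 2) (seq (inc 1) q)) = l at h₂
      generalize hu : update (s 0) 2 (F 0) = u at h₂
      suffices ∀ m, update (s m) 2 (F m) = u → ∃ m, F m = 0 from this 0 hu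
      clear hu
      induction h₂ with
      | inc => cases hl
      | dec => cases hl
      | seq => cases hl
      | loop_zero h =>
        rintro m rfl
        cases hl
        exact ⟨m, by simpa using h⟩
      | loop_succ _ hp _ _ ih =>
        rintro m rfl
        cases hl
        refine ih rfl (m + 1) ?_
        rw [update_idem] at hp
        exact (hround m _).deterministic hp
  · rintro ⟨m, hm⟩
    suffices ∀ j k, k + j = m → ∃ v', Eval (loop 2 (seq (clear 2) (seq (inc 1) q)))
        (update (s k) 2 (F k)) v' by
      obtain ⟨v', h⟩ := this m 0 (by omega)
      exact ⟨v', .seq hstart h⟩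
    intro j
    induction j with
    | zero =>
      rintro k rfl
      exact ⟨_, .loop_zero (by simpa using hm)⟩
    | succ j ih =>
      rintro k hk
      by_cases h0 : F k = 0
      · exact ⟨_, .loop_zero (by simpa using h0)⟩
      · obtain ⟨v', h⟩ := ih (k + 1) (by omega)
        refine ⟨v', .loop_succ (by simpa using h0) ?_ h⟩
        rw [update_idem]
        exact hround k _

end CounterProgram

end PetriNets

/-! ### Counter machines -/

namespace PetriNets

/-- An instruction of a counter machine with control states in `X` and registers numbered by `ℕ`. -/
inductive CounterInstr (X : Type) where
  /-- increment register `r` and go to `s` -/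
  | inc (r : ℕ) (s : X)
  /-- go to `z` if register `r` is zero, otherwise decrement it and go to `s` -/
  | dec (r : ℕ) (s z : X)

namespace CounterInstr

variable {X : Type}

/-- The register that an instruction refers to. -/
def reg : CounterInstr X → ℕ
  | inc r _ => r
  | dec r _ _ => r

/-- The control state and the register contents after an instruction. -/
def exec : CounterInstr X → (ℕ → ℕ) → X × (ℕ → ℕ)
  | inc r s, v => (s, update v r (v r + 1))
  | dec r s z, v => if v r = 0 then (z, v) else (s, update v r (v r - 1))

end CounterInstr

/-- The counter machine `μ`, whose control states are those in `Q` and the final state `none`, halts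
within `n` steps. -/
def HaltsIn {Q : Type} (μ : Q → CounterInstr (Option Q)) : ℕ → Option Q × (ℕ → ℕ) → Prop
  | _, (none, _) => True
  | 0, (some _, _) => False
  | n + 1, (some q, v) => HaltsIn μ n ((μ q).exec v)

/-- The counter machine `μ` halts from the configuration `c`. -/
def Halts {Q : Type} (μ : Q → CounterInstr (Option Q)) (c : Option Q × (ℕ → ℕ)) : Prop :=
  ∃ n, HaltsIn μ n c

section

variable {Q : Type} {μ : Q → CounterInstr (Option Q)}

theorem haltsIn_some {n : ℕ} {q : Q} {v : ℕ → ℕ} :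
    HaltsIn μ n (some q, v) ↔ ∃ m, n = m + 1 ∧ HaltsIn μ m ((μ q).exec v) := by
  cases n <;> simp [HaltsIn]

theorem halts_none (v : ℕ → ℕ) : Halts μ (none, v) := ⟨0, trivial⟩

theorem halts_some {q : Q} {v : ℕ → ℕ} : Halts μ (some q, v) ↔ Halts μ ((μ q).exec v) := by
  simp only [Halts, haltsIn_some]
  grind

end

namespace CounterProgram

/-- The positions of a program, one for each of its elementary instructions and loop heads. -/
def Position : CounterProgram → Type
  | inc _ => Unit
  | dec _ => Unit
  | seq p q => Position p ⊕ Position q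
  | loop _ p => Option (Position p)

instance finite_position (p : CounterProgram) : Finite p.Position := by
  induction p with
  | inc r => exact inferInstanceAs (Finite Unit)
  | dec r => exact inferInstanceAs (Finite Unit)
  | seq p q ihp ihq => exact inferInstanceAs (Finite (p.Position ⊕ q.Position))
  | loop r p ih => exact inferInstanceAs (Finite (Option p.Position))

/-- The position where a program starts. -/
def first : (p : CounterProgram) → p.Position
  | inc _ => ()
  | dec _ => ()
  | seq p _ => Sum.inl p.first
  | loop _ _ => none

/-- The instruction at a position of a program, where `c` embeds the positions into the control
states of a machine, and the program exits to the control state `e`. -/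
def instrAt {X : Type} : (p : CounterProgram) → (p.Position → X) → X → p.Position → CounterInstr X
  | inc r, _, e, _ => .inc r e
  | dec r, _, e, _ => .dec r e e
  | seq p q, c, _, Sum.inl x => instrAt p (fun y => c (Sum.inl y)) (c (Sum.inr q.first)) x
  | seq _ q, c, e, Sum.inr x => instrAt q (fun y => c (Sum.inr y)) e x
  | loop r p, c, e, none => .dec r (c (some p.first)) e
  | loop _ p, c, _, some x => instrAt p (fun y => c (some y)) (c none) x

section

variable {Q : Type} {μ : Q → CounterInstr (Option Q)}

/-- If a program that is part of a machine terminates, and the machine halts from the exit of the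
program, then it halts from the start of the program. -/
theorem halts_of_eval {p : CounterProgram} {v v' : ℕ → ℕ} (h : Eval p v v') (c : p.Position → Q)
    (e : Option Q) (hμ : ∀ x, μ (c x) = instrAt p (fun y => some (c y)) e x)
    (he : Halts μ (e, v')) : Halts μ (some (c p.first), v) := by
  induction h generalizing e with
  | inc r v => rw [halts_some, hμ]; exact he
  | dec r v =>
    rw [halts_some, hμ]
    simp only [instrAt, CounterInstr.exec]
    split_ifs with h0
    · rwa [h0, Nat.zero_sub, ← h0, update_eq_self] at he
    · exact he
  | @seq p q _ _ _ _ _ ihp ihq =>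
    exact ihp (fun x => c (Sum.inl x)) (some (c (Sum.inr q.first)))
      (fun x => hμ (Sum.inl x)) (ihq (fun x => c (Sum.inr x)) e (fun x => hμ (Sum.inr x)) he)
  | @loop_zero r p v h0 =>
    rw [halts_some, hμ]
    simpa only [instrAt, first, CounterInstr.exec, h0, if_true] using he
  | @loop_succ r p _ _ _ h0 _ _ ihp ihl =>
    rw [halts_some, hμ]
    simp only [instrAt, first, CounterInstr.exec, h0, if_false]
    exact ihp (fun x => c (some x)) (some (c none)) (fun x => hμ (some x)) (ihl c e hμ he)

/-- If a machine halts from the start of a program that is part of it, then the program terminates,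
and the machine halts in fewer steps from the exit of the program. -/
theorem exists_eval_of_haltsIn (p : CounterProgram) (c : p.Position → Q) (e : Option Q)
    (hμ : ∀ x, μ (c x) = instrAt p (fun y => some (c y)) e x) (n : ℕ) (v : ℕ → ℕ)
    (h : HaltsIn μ n (some (c p.first), v)) :
    ∃ v' m, m < n ∧ Eval p v v' ∧ HaltsIn μ m (e, v') := by
  induction p generalizing n e v with
  | inc r =>
    obtain ⟨m, rfl, h'⟩ := haltsIn_some.1 h
    rw [hμ] at h'
    exact ⟨_, m, m.lt_succ_self, .inc r v, h'⟩
  | dec r =>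
    obtain ⟨m, rfl, h'⟩ := haltsIn_some.1 h
    rw [hμ] at h'
    refine ⟨_, m, m.lt_succ_self, .dec r v, ?_⟩
    simp only [instrAt, CounterInstr.exec] at h'
    split_ifs at h' with h0
    · rwa [h0, Nat.zero_sub, ← h0, update_eq_self]
    · exact h'
  | seq p q ihp ihq =>
    obtain ⟨v₁, m₁, hm₁, h₁, h⟩ := ihp (fun x => c (Sum.inl x)) (some (c (Sum.inr q.first)))
      (fun x => hμ (Sum.inl x)) n v h
    obtain ⟨v₂, m₂, hm₂, h₂, h⟩ := ihq (fun x => c (Sum.inr x)) e (fun x => hμ (Sum.inr x)) m₁ v₁ h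
    exact ⟨v₂, m₂, by omega, .seq h₁ h₂, h⟩
  | loop r p ih =>
    induction n using Nat.strong_induction_on generalizing v with
    | _ n ihn =>
      obtain ⟨m, rfl, h'⟩ := haltsIn_some.1 h
      rw [hμ] at h'
      simp only [instrAt, first, CounterInstr.exec] at h'
      split_ifs at h' with h0
      · exact ⟨v, m, m.lt_succ_self, .loop_zero h0, h'⟩
      · obtain ⟨v₁, m₁, hm₁, h₁, h⟩ := ih (fun x => c (some x)) (some (c none))
          (fun x => hμ (some x)) m _ h'
        obtain ⟨v₂, m₂, hm₂, h₂, h⟩ := ihn m₁ (by omega) v₁ h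
        exact ⟨v₂, m₂, by omega, .loop_succ h0 h₁ h₂, h⟩

end

/-- The counter machine of a program: its control states are the positions. -/
def machine (p : CounterProgram) : p.Position → CounterInstr (Option p.Position) :=
  p.instrAt some none

theorem halts_machine_iff (p : CounterProgram) (v : ℕ → ℕ) :
    Halts p.machine (some p.first, v) ↔ ∃ v', Eval p v v' := by
  constructor
  · rintro ⟨n, h⟩
    obtain ⟨v', _, _, h, _⟩ := p.exists_eval_of_haltsIn id none (fun _ => rfl) n v h
    exact ⟨v', h⟩
  · rintro ⟨v', h⟩
    exact halts_of_eval h id none (fun _ => rfl) (halts_none v')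

end CounterProgram

open Nat.Partrec (Code) in
/-- A program whose machine searches for the halting time of the partial recursive function with the
index given as input: its halting problem, in terms of the input in
register `0`, is undecidable. -/
theorem exists_undecidable_machine : ∃ p : CounterProgram,
    ¬ ComputablePred fun n => Halts p.machine (some p.first, Pi.single 0 n) := by
  have hf : Primrec fun a : List.Vector ℕ 2 =>
      bif (Code.evaln a.head (Denumerable.ofNat Code a.tail.head) 0).isSome then 0 else 1 := by
    refine .cond ?_ (.const 0) (.const 1)
    exact Primrec.option_isSome.comp (Code.primrec_evaln.comp
      (((Primrec.vector_head).pair ((Primrec.ofNat Code).comp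
        (Primrec.vector_head.comp Primrec.vector_tail))).pair (.const 0)))
  obtain ⟨p, hp⟩ := CounterProgram.exists_search (Nat.Primrec'.of_prim hf)
  refine ⟨p, fun h => ComputablePred.halting_problem 0 ?_⟩
  have key : ∀ c : Code, (Code.eval c 0).Dom ↔
      Halts p.machine (some p.first, Pi.single 0 (Encodable.encode c)) := by
    intro c
    rw [CounterProgram.halts_machine_iff, hp, Part.dom_iff_mem]
    simp only [Code.evaln_complete, List.Vector.head_cons, List.Vector.tail_cons,
      Denumerable.ofNat_encode, Bool.cond_eq_ite, ite_eq_left_iff, one_ne_zero,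
      imp_false, not_not, Option.isSome_iff_exists]
    exact exists_comm
  obtain ⟨_, h⟩ := h
  exact .of_eq ⟨fun _ => inferInstance, h.comp Computable.encode⟩ fun c => (key c).symm

end PetriNets

/-! ### Simulation of counter machines by nets -/

namespace PetriNets

/-- Every set is an initial segment of some linear order. -/
theorem exists_linearOrder_initial {P : Type} (B : Set P) :
    ∃ r : P → P → Prop, IsLinearOrder P r ∧ ∀ p ∈ B, ∀ q, r q p → q ∈ B := by
  let s : P → P → Prop := fun p q => p = q ∨ p ∈ B ∧ q ∉ B
  have hs : IsPartialOrder P s :=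
    { refl := fun _ => .inl rfl
      trans := by rintro a b c (rfl | h) (rfl | h') <;> simp_all [s]
      antisymm := by rintro a b (rfl | h) (h' | h') <;> simp_all }
  obtain ⟨r, hr, hsr⟩ := extend_partialOrder s
  refine ⟨r, hr, fun p hp q hqp => ?_⟩
  by_contra hq
  exact hq (antisymm hqp (hsr _ _ (.inr ⟨hp, hq⟩)) ▸ hp)

theorem HierarchicalNet.fire_of_isNat {P T : Type} [Fintype P] (N : HierarchicalNet P T)
    (M : Marking P) {t : T} (h : ∀ p, (N.pre p t).IsNat) (p : P) :
    N.fire M t p = remaining (N.pre p t) (M p) + N.post t p := by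
  rw [fire, Finset.sum_eq_zero, add_zero]
  intro q _
  obtain ⟨w, hw⟩ := h q
  simp [hw]

namespace CounterInstr

variable {X : Type}

/-- The next control state if the register is not zero. -/
def target : CounterInstr X → X
  | inc _ s => s
  | dec _ s _ => s

/-- The next control state if the register is zero. -/
def zeroTarget : CounterInstr X → X
  | inc _ s => s
  | dec _ _ z => z

end CounterInstr

namespace Simulation

/-- The places of the net that simulates a counter machine with control states `Option Q` and `k`
registers. -/
inductive Place (Q : Type) (k : ℕ) where
  /-- The contents of register `i` are distributed over the places `counter i false` and
  `counter i true`. -/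
  | counter (i : Fin k) (b : Bool)
  /-- The tokens lost in unjustified zero tests. -/
  | trash
  /-- The place `ctrl s` holds a token when the machine is in the control state `s`. -/
  | ctrl (s : Option Q)

/-- The transitions of the net that simulates a counter machine. -/
inductive Transition (Q : Type) (k : ℕ) where
  /-- The instruction at `q`, performed on the place of its register given by `b`; for a decrement,
  this requires a token in that place. -/
  | act (q : Q) (b : Bool)
  /-- A decrement at `q`, under the assumption that its register is zero. For an increment at `q`
  this is a second copy of `act q false`, so that `zero q` is firable in the control state `q`
  whatever the instruction is. -/
  | zero (q : Q)
  /-- Firable as long as there are tokens on `trash`, with no effect. -/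
  | spin
  /-- Removes a token from a register after the machine has halted. -/
  | drain (i : Fin k) (b : Bool)

open Place Transition

variable {Q : Type} {k : ℕ}

instance [Finite Q] : Finite (Place Q k) :=
  Finite.of_injective (β := (Fin k × Bool) ⊕ Option (Option Q))
    (fun p => match p with
      | counter i b => .inl (i, b)
      | trash => .inr none
      | ctrl s => .inr (some s))
    (by rintro (_ | _ | _) (_ | _ | _) h <;> simp_all)

instance [Finite Q] : Finite (Transition Q k) :=
  Finite.of_injective (β := (Q × Option Bool) ⊕ Option (Fin k × Bool))
    (fun t => match t with
      | act q b => .inl (q, some b)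
      | zero q => .inl (q, none)
      | spin => .inr none
      | drain i b => .inr (some (i, b)))
    (by rintro (_ | _ | _ | _) (_ | _ | _ | _) h <;> simp_all)

open Classical in
/-- The arcs from places to transitions. When the register of `q` is assumed to be zero, the
contents of its two places are moved to `trash`, and the two places of each other register exchange
their contents. -/
noncomputable def pre (μ : Q → CounterInstr (Option Q)) :
    Place Q k → Transition Q k → Arc (Place Q k)
  | ctrl s, act q _ => .weight (if s = some q then 1 else 0)
  | ctrl s, zero q => .weight (if s = some q then 1 else 0)
  | ctrl s, drain _ _ => .weight (if s = none then 1 else 0)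
  | ctrl _, spin => .weight 0
  | trash, spin => .weight 1
  | trash, _ => .weight 0
  | counter i b, act q b' =>
    match μ q with
    | .inc _ _ => .weight 0
    | .dec r _ _ => .weight (if (i : ℕ) = r ∧ b = b' then 1 else 0)
  | counter i b, zero q =>
    match μ q with
    | .inc _ _ => .weight 0
    | .dec r _ _ => .transfer (if (i : ℕ) = r then trash else counter i !b)
  | counter i b, drain j b' => .weight (if i = j ∧ b = b' then 1 else 0)
  | counter _ _, spin => .weight 0

open Classical in
/-- The weights of the arcs from transitions to places. -/
noncomputable def post (μ : Q → CounterInstr (Option Q)) : Transition Q k → Place Q k → ℕ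
  | act q _, ctrl s => if s = (μ q).target then 1 else 0
  | zero q, ctrl s => if s = (μ q).zeroTarget then 1 else 0
  | drain _ _, ctrl s => if s = none then 1 else 0
  | spin, trash => 1
  | act q b', counter i b =>
    match μ q with
    | .inc r _ => if (i : ℕ) = r ∧ b = b' then 1 else 0
    | .dec _ _ _ => 0
  | zero q, counter i b =>
    match μ q with
    | .inc r _ => if (i : ℕ) = r ∧ b = false then 1 else 0
    | .dec _ _ _ => 0
  | _, _ => 0

theorem exists_counter_of_not_isNat {μ : Q → CounterInstr (Option Q)} {p : Place Q k}
    {t : Transition Q k} (h : ¬ (pre μ p t).IsNat) : ∃ i b, p = counter i b := by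
  rcases p with ⟨i, b⟩ | _ | s
  · exact ⟨i, b, rfl⟩
  · exact absurd (by cases t <;> exact ⟨_, rfl⟩) h
  · exact absurd (by cases t <;> exact ⟨_, rfl⟩) h

theorem exists_counter_of_transfer {μ : Q → CounterInstr (Option Q)} {p p' : Place Q k}
    {t : Transition Q k} (h : pre μ p t = .transfer p') : ∃ i b, p = counter i b :=
  exists_counter_of_not_isNat (t := t) (by rintro ⟨w, hw⟩; rw [h] at hw; cases hw)

theorem pre_counter_zero (μ : Q → CounterInstr (Option Q)) {q : Q} {r : ℕ} {s z : Option Q}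
    (hq : μ q = .dec r s z) (i : Fin k) (b : Bool) :
    pre μ (counter i b) (zero q) = .transfer (if (i : ℕ) = r then trash else counter i !b) := by
  simp [pre, hq]

theorem exists_dec_of_not_isNat {μ : Q → CounterInstr (Option Q)} {p : Place Q k}
    {t : Transition Q k} (h : ¬ (pre μ p t).IsNat) : ∃ q r s z, t = zero q ∧ μ q = .dec r s z := by
  obtain ⟨i, b, rfl⟩ := exists_counter_of_not_isNat h
  cases t with
  | act q b' => exact absurd (by simp only [pre]; cases μ q <;> exact ⟨_, rfl⟩) h
  | spin => exact absurd ⟨_, rfl⟩ h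
  | drain j b' => exact absurd ⟨_, rfl⟩ h
  | zero q =>
    cases hq : μ q with
    | inc r s => exact absurd (by simp only [pre, hq]; exact ⟨_, rfl⟩) h
    | dec r s z => exact ⟨q, r, s, z, rfl, hq⟩

/-- The net that simulates the counter machine `μ`, using the registers below `k`. -/
noncomputable def net (μ : Q → CounterInstr (Option Q)) (init : Marking (Place Q k)) :
    HierarchicalNet (Place Q k) (Transition Q k) where
  pre := pre μ
  post := post μ
  -- any order that puts the counters below the other places will do
  hle := (exists_linearOrder_initial {p | ∃ i b, p = counter i b}).choose
  hle_linear := (exists_linearOrder_initial _).choose_spec.1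
  init := init
  hierarchical := by
    intro p t hp q hqp
    obtain ⟨i, b, rfl⟩ :=
      (exists_linearOrder_initial {p : Place Q k | ∃ i b, p = counter i b}).choose_spec.2 p
        (exists_counter_of_not_isNat hp) q hqp
    obtain ⟨q, r, s, z, rfl, hq⟩ := exists_dec_of_not_isNat hp
    rw [pre_counter_zero μ hq]
    rintro ⟨w, hw⟩
    cases hw

variable (μ : Q → CounterInstr (Option Q)) (init : Marking (Place Q k))

theorem transferOnly_net : (net μ init).TransferOnly := by
  intro p t hp
  obtain ⟨i, b, rfl⟩ := exists_counter_of_not_isNat hp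
  obtain ⟨q, r, s, z, rfl, hq⟩ := exists_dec_of_not_isNat hp
  exact ⟨_, pre_counter_zero μ hq i b⟩

/-- The number of tokens in the places of a register. -/
def tokens (M : Marking (Place Q k)) (i : Fin k) : ℕ := M (counter i false) + M (counter i true)

open Classical in
/-- The marking `M` is in the control state `s`. -/
def InState (M : Marking (Place Q k)) (s : Option Q) : Prop :=
  ∀ s', M (ctrl s') = if s' = s then 1 else 0

/-- The marking `M` represents the configuration `c` of the machine. -/
structure Represents (M : Marking (Place Q k)) (c : Option Q × (ℕ → ℕ)) : Prop where
  inState : InState M c.1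
  tokens_eq : ∀ i, tokens M i = c.2 i
  trash_eq : M trash = 0

open Classical in
/-- The marking with a single token, in the final control state. -/
noncomputable def finalMarking : Marking (Place Q k) := Pi.single (ctrl none) 1

variable {μ init}

theorem isNat_act (q : Q) (b : Bool) (p : Place Q k) : ((net μ init).pre p (act q b)).IsNat := by
  by_contra h
  obtain ⟨_, _, _, _, h, _⟩ := exists_dec_of_not_isNat h
  cases h

theorem isNat_spin (p : Place Q k) : ((net μ init).pre p spin).IsNat := by
  by_contra h
  obtain ⟨_, _, _, _, h, _⟩ := exists_dec_of_not_isNat h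
  cases h

theorem isNat_drain (i : Fin k) (b : Bool) (p : Place Q k) :
    ((net μ init).pre p (drain i b)).IsNat := by
  by_contra h
  obtain ⟨_, _, _, _, h, _⟩ := exists_dec_of_not_isNat h
  cases h

theorem isNat_zero {q : Q} {r : ℕ} {s : Option Q} (hq : μ q = .inc r s) (p : Place Q k) :
    ((net μ init).pre p (zero q)).IsNat := by
  by_contra h
  obtain ⟨_, _, _, _, h, hq'⟩ := exists_dec_of_not_isNat h
  cases h
  rw [hq] at hq'
  cases hq'

section

variable {M : Marking (Place Q k)} {q : Q} {s z : Option Q}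

theorem firable_zero (hM : InState M (some q)) : (net μ init).Firable M (zero q) := by
  intro p
  rcases p with ⟨i, b⟩ | _ | s'
  · cases hq : μ q <;> simp [net, pre, hq, HierarchicalNet.Enables]
  · simp [net, pre, HierarchicalNet.Enables]
  · simp [net, pre, HierarchicalNet.Enables, hM s']

theorem InState.eq_of_pos (hM : InState M s) (h : 1 ≤ M (ctrl z)) : z = s := by
  by_contra hne
  rw [hM, if_neg hne] at h
  omega

theorem deadlocked_final : (net μ init).Deadlocked finalMarking := by
  rintro (⟨q, b⟩ | q | _ | ⟨i, b⟩) h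
  · simpa [net, pre, HierarchicalNet.Enables, finalMarking] using h (ctrl (some q))
  · simpa [net, pre, HierarchicalNet.Enables, finalMarking] using h (ctrl (some q))
  · simpa [net, pre, HierarchicalNet.Enables, finalMarking] using h trash
  · simpa [net, pre, HierarchicalNet.Enables, finalMarking] using h (counter i b)

/-- The invariant of all runs from a marking that represents the configuration `c`: there is one
control state, and as long as no token was lost in a zero test, the run was a faithful simulation,
so that `c` halts if the current configuration does. -/
def Invariant (μ : Q → CounterInstr (Option Q)) (c : Option Q × (ℕ → ℕ)) (M : Marking (Place Q k)) :
    Prop :=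
  ∃ s, InState M s ∧ (M trash = 0 → ∃ v : ℕ → ℕ, (s ≠ none → ∀ i : Fin k, tokens M i = v i) ∧
    (Halts μ (s, v) → Halts μ c))

/-- At a deadlock, `spin` shows that `trash` is empty, and the transitions `zero q` show that the
control state is the final one. -/
theorem Invariant.halts_of_deadlocked {c : Option Q × (ℕ → ℕ)} (hM : Invariant μ c M)
    (h : (net μ init).Deadlocked M) : Halts μ c := by
  obtain ⟨s, hs, hv⟩ := hM
  have htr : M trash = 0 := by
    by_contra hne
    refine h spin ?_
    rintro (⟨i, b⟩ | _ | s')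
    · simp [net, pre, HierarchicalNet.Enables]
    · simp only [net, pre, HierarchicalNet.Enables]
      omega
    · simp [net, pre, HierarchicalNet.Enables]
  obtain ⟨v, -, hh⟩ := hv htr
  cases s with
  | none => exact hh (halts_none v)
  | some q => exact absurd (firable_zero hs) (h (zero q))

end

section

variable [Fintype (Place Q k)] {M : Marking (Place Q k)} {q : Q} {r : ℕ} {s z : Option Q}

theorem fire_zero_control (s' : Option Q) (hq : μ q = .dec r s z) :
    (net μ init).fire M (zero q) (ctrl s') =
      HierarchicalNet.remaining (pre μ (ctrl s' : Place Q k) (zero q)) (M (ctrl s')) +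
        post (k := k) μ (zero q) (ctrl s') := by
  rw [HierarchicalNet.fire, Finset.sum_eq_zero, add_zero]
  · rfl
  · intro p _
    rw [if_neg]
    intro h
    obtain ⟨i, b, rfl⟩ := exists_counter_of_transfer h
    have h' := (pre_counter_zero μ hq i b).symm.trans h
    split_ifs at h' <;> cases h'

/-- A zero test exchanges the contents of the two places of any other register. -/
theorem fire_zero_counter {i : Fin k} (hq : μ q = .dec r s z) (hi : (i : ℕ) ≠ r) (b : Bool) :
    (net μ init).fire M (zero q) (counter i b) = M (counter i !b) := by
  rw [HierarchicalNet.fire, Finset.sum_eq_single (counter i !b)]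
  · have h : (net μ init).pre (counter i !b) (zero q) = .transfer (counter i b) :=
      (pre_counter_zero μ hq i _).trans (by simp [hi])
    have h' : (net μ init).pre (counter i b) (zero q) = .transfer (counter i !b) :=
      (pre_counter_zero μ hq i _).trans (by simp [hi])
    rw [if_pos h, h']
    simp [HierarchicalNet.remaining, net, post, hq]
  · intro p _ hp
    rw [if_neg]
    intro h
    obtain ⟨j, b', rfl⟩ := exists_counter_of_transfer h
    have h' := (pre_counter_zero μ hq j b').symm.trans h
    split_ifs at h'
    · cases h'
    · simp only [Arc.transfer.injEq, counter.injEq] at h'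
      obtain ⟨rfl, rfl⟩ := h'
      simp at hp
  · intro h
    exact absurd (Finset.mem_univ _) h

/-- A zero test empties the places of its register. -/
theorem fire_zero_self {i : Fin k} (hq : μ q = .dec r s z) (hi : (i : ℕ) = r) (b : Bool) :
    (net μ init).fire M (zero q) (counter i b) = 0 := by
  rw [HierarchicalNet.fire, Finset.sum_eq_zero]
  · have h' : (net μ init).pre (counter i b) (zero q) = .transfer trash :=
      (pre_counter_zero μ hq i _).trans (by simp [hi])
    rw [h']
    simp [HierarchicalNet.remaining, net, post, hq]
  · intro p _
    rw [if_neg]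
    intro h
    obtain ⟨j, b', rfl⟩ := exists_counter_of_transfer h
    have h' := (pre_counter_zero μ hq j b').symm.trans h
    split_ifs at h' with hj
    · cases h'
    · simp only [Arc.transfer.injEq, counter.injEq] at h'
      exact hj (h'.1 ▸ hi)

/-- After a zero test, `trash` is empty if and only if it was empty before and the test was
justified. -/
theorem fire_zero_trash {i : Fin k} (hq : μ q = .dec r s z) (hi : (i : ℕ) = r) :
    (net μ init).fire M (zero q) trash = 0 ↔ M trash = 0 ∧ tokens M i = 0 := by
  simp only [HierarchicalNet.fire, add_eq_zero, Finset.sum_eq_zero_iff, Finset.mem_univ,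
    forall_const, ite_eq_right_iff, tokens]
  have hpre : ∀ b, (net μ init).pre (counter i b) (zero q) = .transfer trash := fun b =>
    (pre_counter_zero μ hq i _).trans (by simp [hi])
  constructor
  · rintro ⟨⟨h₁, h₂⟩, -⟩
    exact ⟨h₁, h₂ _ (hpre _), h₂ _ (hpre _)⟩
  · rintro ⟨h₁, h₂, h₃⟩
    refine ⟨⟨h₁, fun p h => ?_⟩, rfl⟩
    obtain ⟨j, b', rfl⟩ := exists_counter_of_transfer h
    have h' := (pre_counter_zero μ hq j b').symm.trans h
    split_ifs at h' with hj
    · obtain rfl : i = j := Fin.ext (hi.trans hj.symm)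
      cases b' <;> assumption
    · cases h'

/-- Every step of the machine can be simulated. -/
theorem Represents.exists_step (hμ : ∀ q, (μ q).reg < k) {v : ℕ → ℕ}
    (hM : Represents M (some q, v)) :
    ∃ M', (net μ init).Step M M' ∧ Represents M' ((μ q).exec v) := by
  have hk := hμ q
  cases hq : μ q with
  | inc r s =>
    refine ⟨_, ⟨zero q, firable_zero hM.inState, rfl⟩, ?_, ?_, ?_⟩
    · intro s'
      rw [HierarchicalNet.fire_of_isNat _ _ (isNat_zero hq)]
      have := hM.inState s'
      simp only at this
      simp only [net, pre, post, HierarchicalNet.remaining, this, hq, CounterInstr.zeroTarget,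
        CounterInstr.exec]
      grind
    · intro i
      simp only [tokens]
      rw [HierarchicalNet.fire_of_isNat _ _ (isNat_zero hq),
        HierarchicalNet.fire_of_isNat _ _ (isNat_zero hq)]
      have := hM.tokens_eq i
      simp only [tokens] at this
      simp only [net, pre, post, HierarchicalNet.remaining, hq, CounterInstr.exec, update_apply]
      grind
    · rw [HierarchicalNet.fire_of_isNat _ _ (isNat_zero hq)]
      simp [net, pre, post, HierarchicalNet.remaining, hM.trash_eq]
  | dec r s z =>
    rw [hq] at hk
    by_cases h0 : v r = 0
    · refine ⟨_, ⟨zero q, firable_zero hM.inState, rfl⟩, ?_⟩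
      simp only [CounterInstr.exec, h0, if_true]
      refine ⟨?_, ?_, ?_⟩
      · intro s'
        rw [fire_zero_control s' hq]
        have := hM.inState s'
        simp only at this
        simp only [pre, post, HierarchicalNet.remaining, this, hq, CounterInstr.zeroTarget]
        grind
      · intro i
        by_cases hi : (i : ℕ) = r
        · simp only [tokens, fire_zero_self hq hi, hi, h0]
        · simp only [tokens, fire_zero_counter hq hi]
          exact (add_comm _ _).trans (hM.tokens_eq i)
      · rw [fire_zero_trash (i := ⟨r, hk⟩) hq rfl]
        exact ⟨hM.trash_eq, (hM.tokens_eq _).trans h0⟩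
    · have hpos := hM.tokens_eq ⟨r, hk⟩
      obtain ⟨b, hb⟩ : ∃ b, 1 ≤ M (counter ⟨r, hk⟩ b) := by
        by_contra! hlt
        have h₁ := hlt false
        have h₂ := hlt true
        simp only [tokens] at hpos
        omega
      refine ⟨_, ⟨act q b, ?_, rfl⟩, ?_⟩
      · rintro (⟨i, b'⟩ | _ | s')
        · simp only [net, pre, hq, HierarchicalNet.Enables]
          split_ifs with h
          · obtain ⟨rfl, rfl⟩ := h
            exact hb
          · exact Nat.zero_le _
        · simp [net, pre, HierarchicalNet.Enables]
        · have := hM.inState s'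
          simp only at this
          simp [net, pre, HierarchicalNet.Enables, this]
      · simp only [CounterInstr.exec, h0, if_false]
        refine ⟨?_, ?_, ?_⟩
        · intro s'
          rw [HierarchicalNet.fire_of_isNat _ _ (isNat_act q b)]
          have := hM.inState s'
          simp only at this
          simp only [net, pre, post, HierarchicalNet.remaining, this, hq, CounterInstr.target]
          grind
        · intro i
          simp only [tokens]
          rw [HierarchicalNet.fire_of_isNat _ _ (isNat_act q b),
            HierarchicalNet.fire_of_isNat _ _ (isNat_act q b)]
          have := hM.tokens_eq i
          simp only [tokens] at this
          simp only [net, pre, post, HierarchicalNet.remaining, hq, update_apply]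
          by_cases hi : (i : ℕ) = r
          · obtain rfl : i = ⟨r, hk⟩ := Fin.ext hi
            dsimp only at this
            cases b <;> simp <;> omega
          · simp [hi, this]
        · rw [HierarchicalNet.fire_of_isNat _ _ (isNat_act q b)]
          simp [net, pre, post, HierarchicalNet.remaining, hM.trash_eq]

open Classical in
/-- Once the machine has halted, the counters can be emptied by the transitions `drain`. -/
theorem Represents.reachable_final {v : ℕ → ℕ} (hM : Represents M (none, v)) :
    Relation.ReflTransGen (net μ init).Step M finalMarking := by
  induction hn : ∑ p, M p using Nat.strong_induction_on generalizing M v with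
  | _ n ih =>
    by_cases h : ∃ i b, M (counter i b) ≠ 0
    · obtain ⟨i, b, hib⟩ := h
      have hfire : ∀ p, (net μ init).fire M (drain i b) p =
          if p = counter i b then M p - 1 else M p := by
        intro p
        rw [HierarchicalNet.fire_of_isNat _ _ (isNat_drain i b)]
        have hc := hM.inState none
        simp only [if_true] at hc
        rcases p with ⟨j, b'⟩ | _ | (_ | s')
        · simp only [net, pre, post, HierarchicalNet.remaining, counter.injEq]
          grind
        · simp [net, pre, post, HierarchicalNet.remaining]
        · simp [net, pre, post, HierarchicalNet.remaining, hc]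
        · simp [net, pre, post, HierarchicalNet.remaining]
      refine .head ⟨drain i b, ?_, rfl⟩
        (ih _ ?_ (v := fun r => if h : r < k then
          tokens ((net μ init).fire M (drain i b)) ⟨r, h⟩ else 0) ?_ rfl)
      · rintro (⟨j, b'⟩ | _ | s')
        · simp only [net, pre, HierarchicalNet.Enables]
          split_ifs with h
          · obtain ⟨rfl, rfl⟩ := h
            omega
          · exact Nat.zero_le _
        · simp [net, pre, HierarchicalNet.Enables]
        · have := hM.inState s'
          simp only at this
          simp [net, pre, HierarchicalNet.Enables, this]
      · rw [← hn]
        refine Finset.sum_lt_sum (fun p _ => ?_) ⟨counter i b, Finset.mem_univ _, ?_⟩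
        · rw [hfire]
          split_ifs <;> omega
        · rw [hfire, if_pos rfl]
          omega
      · refine ⟨fun s' => ?_, fun j => ?_, ?_⟩
        · rw [hfire, if_neg (by simp)]
          exact hM.inState s'
        · simp
        · rw [hfire, if_neg (by simp)]
          exact hM.trash_eq
    · push Not at h
      have : M = finalMarking := by
        funext p
        rcases p with ⟨j, b'⟩ | _ | s'
        · simp [finalMarking, h]
        · simp [finalMarking, hM.trash_eq]
        · have := hM.inState s'
          simp only at this
          simp [finalMarking, this, Pi.single_apply]
      rw [this]

theorem reachable_of_halts (hμ : ∀ q, (μ q).reg < k) {c : Option Q × (ℕ → ℕ)}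
    (hM : Represents init c) (h : Halts μ c) : (net μ init).Reachable finalMarking := by
  obtain ⟨n, h⟩ := h
  suffices ∀ M, Represents M c → Relation.ReflTransGen (net μ init).Step M finalMarking from
    this init hM
  clear hM
  induction n generalizing c with
  | zero =>
    obtain ⟨_ | q, v⟩ := c
    · exact fun M hM => hM.reachable_final
    · exact h.elim
  | succ n ih =>
    obtain ⟨_ | q, v⟩ := c
    · exact fun M hM => hM.reachable_final
    · intro M hM
      obtain ⟨M', hstep, hM'⟩ := hM.exists_step (init := init) hμ
      exact .head hstep (ih h M' hM')

theorem Invariant.step (hμ : ∀ q, (μ q).reg < k) {c : Option Q × (ℕ → ℕ)}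
    {M' : Marking (Place Q k)} (hM : Invariant μ c M) (h : (net μ init).Step M M') :
    Invariant μ c M' := by
  obtain ⟨s, hs, hv⟩ := hM
  obtain ⟨t, ht, rfl⟩ := h
  cases t with
  | act q b =>
    have hk := hμ q
    obtain rfl : some q = s := hs.eq_of_pos
      (by simpa [net, pre, HierarchicalNet.Enables] using ht (ctrl (some q)))
    refine ⟨(μ q).target, fun s' => ?_, fun htr => ?_⟩
    · rw [HierarchicalNet.fire_of_isNat _ _ (isNat_act q b)]
      simp only [net, pre, post, HierarchicalNet.remaining, hs s']
      grind
    · rw [HierarchicalNet.fire_of_isNat _ _ (isNat_act q b)] at htr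
      simp only [net, pre, post, HierarchicalNet.remaining, Nat.sub_zero, add_zero] at htr
      obtain ⟨v, hv, hh⟩ := hv htr
      have hv := hv (by simp)
      rw [halts_some] at hh
      cases hq : μ q with
      | inc r s =>
        rw [hq] at hh hk
        refine ⟨_, fun _ i => ?_, hh⟩
        simp only [tokens]
        rw [HierarchicalNet.fire_of_isNat _ _ (isNat_act q b),
          HierarchicalNet.fire_of_isNat _ _ (isNat_act q b)]
        have := hv i
        simp only [tokens] at this
        simp only [net, pre, post, HierarchicalNet.remaining, hq, update_apply]
        grind
      | dec r s z =>
        rw [hq] at hh hk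
        have hb : 1 ≤ M (counter ⟨r, hk⟩ b) := by
          simpa [net, pre, hq, HierarchicalNet.Enables] using ht (counter ⟨r, hk⟩ b)
        have h0 : v r ≠ 0 := by
          have := hv ⟨r, hk⟩
          simp only [tokens] at this
          cases b <;> omega
        simp only [CounterInstr.exec, h0, if_false] at hh
        refine ⟨_, fun _ i => ?_, hh⟩
        simp only [tokens]
        rw [HierarchicalNet.fire_of_isNat _ _ (isNat_act q b),
          HierarchicalNet.fire_of_isNat _ _ (isNat_act q b)]
        have := hv i
        simp only [tokens] at this
        simp only [net, pre, post, HierarchicalNet.remaining, hq, update_apply]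
        by_cases hi : (i : ℕ) = r
        · obtain rfl : i = ⟨r, hk⟩ := Fin.ext hi
          dsimp only at this
          cases b <;> simp <;> omega
        · simp [hi, this]
  | zero q =>
    have hk := hμ q
    obtain rfl : some q = s := hs.eq_of_pos
      (by simpa [net, pre, HierarchicalNet.Enables] using ht (ctrl (some q)))
    refine ⟨(μ q).zeroTarget, fun s' => ?_, fun htr => ?_⟩
    · cases hq : μ q with
      | inc r s =>
        rw [HierarchicalNet.fire_of_isNat _ _ (isNat_zero hq)]
        simp only [net, pre, post, HierarchicalNet.remaining, hs s', hq]
        grind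
      | dec r s z =>
        rw [fire_zero_control s' hq]
        simp only [pre, post, HierarchicalNet.remaining, hs s', hq]
        grind
    · cases hq : μ q with
      | inc r s =>
        rw [HierarchicalNet.fire_of_isNat _ _ (isNat_zero hq)] at htr
        simp only [net, pre, post, HierarchicalNet.remaining, Nat.sub_zero, add_zero] at htr
        obtain ⟨v, hv, hh⟩ := hv htr
        have hv := hv (by simp)
        rw [halts_some, hq] at hh
        refine ⟨_, fun _ i => ?_, hh⟩
        simp only [tokens]
        rw [HierarchicalNet.fire_of_isNat _ _ (isNat_zero hq),
          HierarchicalNet.fire_of_isNat _ _ (isNat_zero hq)]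
        have := hv i
        simp only [tokens] at this
        simp only [net, pre, post, HierarchicalNet.remaining, hq, update_apply]
        grind
      | dec r s z =>
        rw [hq] at hk
        obtain ⟨htr, htok⟩ := (fire_zero_trash (i := ⟨r, hk⟩) hq rfl).1 htr
        obtain ⟨v, hv, hh⟩ := hv htr
        have hv := hv (by simp)
        have h0 : v r = 0 := (hv ⟨r, hk⟩).symm.trans htok
        rw [halts_some, hq] at hh
        simp only [CounterInstr.exec, h0, if_true] at hh
        refine ⟨_, fun _ i => ?_, hh⟩
        by_cases hi : (i : ℕ) = r
        · simp only [tokens, fire_zero_self hq hi, hi, h0]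
        · simp only [tokens, fire_zero_counter hq hi]
          exact (add_comm _ _).trans (hv i)
  | spin =>
    have hpos : 1 ≤ M trash := ht trash
    have hfire : (net μ init).fire M spin = M := by
      funext p
      rw [HierarchicalNet.fire_of_isNat _ _ isNat_spin]
      rcases p with ⟨i, b⟩ | _ | s'
      · simp [net, pre, post, HierarchicalNet.remaining]
      · simp only [net, pre, post, HierarchicalNet.remaining]
        omega
      · simp [net, pre, post, HierarchicalNet.remaining]
    rw [hfire]
    exact ⟨s, hs, hv⟩
  | drain i b =>
    obtain rfl : none = s := hs.eq_of_pos
      (by simpa [net, pre, HierarchicalNet.Enables] using ht (ctrl none))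
    refine ⟨none, fun s' => ?_, fun htr => ?_⟩
    · rw [HierarchicalNet.fire_of_isNat _ _ (isNat_drain i b)]
      simp only [net, pre, post, HierarchicalNet.remaining, hs s']
      grind
    · rw [HierarchicalNet.fire_of_isNat _ _ (isNat_drain i b)] at htr
      simp only [net, pre, post, HierarchicalNet.remaining, Nat.sub_zero, add_zero] at htr
      obtain ⟨v, -, hh⟩ := hv htr
      exact ⟨v, fun h => absurd rfl h, hh⟩

theorem halts_of_hasReachableDeadlock (hμ : ∀ q, (μ q).reg < k) {c : Option Q × (ℕ → ℕ)}
    (hM : Represents init c) (h : (net μ init).HasReachableDeadlock) : Halts μ c := by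
  obtain ⟨M, hreach, hdead⟩ := h
  refine Invariant.halts_of_deadlocked ?_ hdead
  clear hdead
  induction hreach with
  | refl => exact ⟨c.1, hM.inState, fun _ => ⟨c.2, fun _ i => hM.tokens_eq i, id⟩⟩
  | tail _ hstep ih => exact ih.step hμ hstep

theorem hasReachableDeadlock_iff (hμ : ∀ q, (μ q).reg < k) {c : Option Q × (ℕ → ℕ)}
    (hM : Represents init c) : (net μ init).HasReachableDeadlock ↔ Halts μ c :=
  ⟨halts_of_hasReachableDeadlock hμ hM,
    fun h => ⟨_, reachable_of_halts hμ hM h, deadlocked_final⟩⟩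

theorem reachable_final_iff (hμ : ∀ q, (μ q).reg < k) {c : Option Q × (ℕ → ℕ)}
    (hM : Represents init c) : (net μ init).Reachable finalMarking ↔ Halts μ c :=
  ⟨fun h => halts_of_hasReachableDeadlock hμ hM ⟨_, h, deadlocked_final⟩,
    reachable_of_halts hμ hM⟩

end

end Simulation

end PetriNets

/-! ### Numbering of places and transitions, and the reduction -/

namespace PetriNets

/-- Renaming the places in a label. -/
def Arc.map {P P' : Type} (e : P → P') : Arc P → Arc P'
  | weight w => weight w
  | inhibitor => inhibitor
  | reset => reset
  | transfer q => transfer (e q)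

theorem Arc.isNat_map {P P' : Type} (e : P → P') (a : Arc P) : (a.map e).IsNat ↔ a.IsNat := by
  cases a <;> simp [Arc.map, Arc.IsNat]

theorem Arc.map_eq_transfer {P P' : Type} (e : P ≃ P') (a : Arc P) (p : P) :
    a.map e = transfer (e p) ↔ a = transfer p := by
  cases a <;> simp [Arc.map]

namespace HierarchicalNet

variable {P T P' T' : Type}

/-- Renaming the places and the transitions of a net. -/
def reindex (N : HierarchicalNet P T) (eP : P ≃ P') (eT : T ≃ T') : HierarchicalNet P' T' where
  pre p t := (N.pre (eP.symm p) (eT.symm t)).map eP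
  post t p := N.post (eT.symm t) (eP.symm p)
  hle p q := N.hle (eP.symm p) (eP.symm q)
  hle_linear :=
    haveI := N.hle_linear
    eP.symm.injective.isLinearOrder_onFun N.hle
  init p := N.init (eP.symm p)
  hierarchical p t hp q hqp := by
    rw [Arc.isNat_map] at hp ⊢
    exact N.hierarchical _ _ hp _ hqp

variable (N : HierarchicalNet P T) (eP : P ≃ P') (eT : T ≃ T')

theorem TransferOnly.reindex {N : HierarchicalNet P T} (h : N.TransferOnly) :
    (N.reindex eP eT).TransferOnly := by
  intro p t hp
  obtain ⟨q, hq⟩ := h _ _ ((Arc.isNat_map eP _).not.1 hp)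
  exact ⟨eP q, by simp only [HierarchicalNet.reindex, hq, Arc.map]⟩

theorem firable_reindex (M : Marking P') (t : T) :
    (N.reindex eP eT).Firable M (eT t) ↔ N.Firable (M ∘ eP) t := by
  rw [Firable, Firable, ← eP.forall_congr_right]
  refine forall_congr' fun p => ?_
  simp only [reindex, Equiv.symm_apply_apply, Function.comp_apply]
  cases N.pre p t <;> rfl

theorem deadlocked_reindex (M : Marking P') :
    (N.reindex eP eT).Deadlocked M ↔ N.Deadlocked (M ∘ eP) := by
  rw [Deadlocked, Deadlocked, ← eT.forall_congr_right]
  exact forall_congr' fun t => (N.firable_reindex eP eT M t).not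

variable [Fintype P] [Fintype P']

open Classical in
theorem fire_reindex (M : Marking P') (t : T) :
    (N.reindex eP eT).fire M (eT t) ∘ eP = N.fire (M ∘ eP) t := by
  funext p
  simp only [fire, Function.comp_apply]
  rw [← eP.sum_comp]
  simp only [reindex, Equiv.symm_apply_apply]
  congr 2
  · cases N.pre p t <;> rfl
  · refine Finset.sum_congr rfl fun q _ => if_congr ?_ rfl rfl
    exact Arc.map_eq_transfer eP _ p

theorem step_reindex (M₁ M₂ : Marking P') :
    (N.reindex eP eT).Step M₁ M₂ ↔ N.Step (M₁ ∘ eP) (M₂ ∘ eP) := by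
  rw [Step, Step, ← eT.exists_congr_right]
  refine exists_congr fun t => and_congr (N.firable_reindex eP eT M₁ t) ?_
  rw [← N.fire_reindex eP eT, eP.surjective.injective_comp_right.eq_iff]

theorem reachable_reindex (M : Marking P') :
    (N.reindex eP eT).Reachable M ↔ N.Reachable (M ∘ eP) := by
  have hinit : (N.reindex eP eT).init ∘ eP = N.init := by
    funext p
    simp [reindex]
  constructor
  · intro h
    rw [Reachable, ← hinit]
    exact h.lift (· ∘ eP) fun _ _ h => (N.step_reindex eP eT _ _).1 h
  · intro h
    have h' := h.lift (p := (N.reindex eP eT).Step) (· ∘ eP.symm) fun M₁ M₂ h => by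
      rw [onFun, N.step_reindex]
      simpa [Function.comp_assoc] using h
    rw [← hinit] at h'
    simpa [Reachable, onFun, Function.comp_assoc] using h'

theorem hasReachableDeadlock_reindex :
    (N.reindex eP eT).HasReachableDeadlock ↔ N.HasReachableDeadlock := by
  rw [HasReachableDeadlock, HasReachableDeadlock,
    ← (eP.arrowCongr (Equiv.refl ℕ)).exists_congr_right]
  refine exists_congr fun M => ?_
  rw [N.reachable_reindex, N.deadlocked_reindex]
  have : (eP.arrowCongr (Equiv.refl ℕ)) M ∘ eP = M := by
    funext p
    simp
  rw [this]

end HierarchicalNet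

/-- If an algorithm decides a problem, then it decides every predicate that reduces to it by a
computable translation into descriptions of inputs. -/
theorem AlgorithmicallyDecidable.computablePred {α C : Type} [Primcodable C] {code : α → C}
    {p : α → Prop} (h : AlgorithmicallyDecidable code p) {r : ℕ → α}
    (hr : Computable fun n => code (r n)) : ComputablePred fun n => p (r n) := by
  classical
  obtain ⟨f, hf, hp⟩ := h
  refine ⟨fun _ => inferInstance, (hf.comp hr).of_eq fun n => Part.eq_some_iff.2 ?_⟩
  by_cases h : p (r n)
  · simpa [h] using (hp (r n)).1 h
  · simpa [h] using (hp (r n)).2 h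

open Simulation

/-- A counter machine is simulated by nets that differ in their initial markings only, so that their
descriptions can be computed from the input of the machine. -/
theorem exists_computable_family {Q : Type} [Finite Q] (μ : Q → CounterInstr (Option Q)) (q₀ : Q) :
    ∃ x : ℕ → ReachInput, (Computable fun n => (x n).code) ∧
      (∀ n, (x n).htpn.net.Reachable (x n).target ↔ Halts μ (some q₀, Pi.single 0 n)) ∧
      ∀ n, (x n).htpn.net.HasReachableDeadlock ↔ Halts μ (some q₀, Pi.single 0 n) := by
  classical
  obtain ⟨k, hk⟩ : ∃ k, ∀ q, (μ q).reg < k + 1 := by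
    obtain ⟨k, hk⟩ := (Set.finite_range fun q => (μ q).reg).bddAbove
    exact ⟨k, fun q => Nat.lt_succ_of_le (hk ⟨q, rfl⟩)⟩
  have := Fintype.ofFinite (Place Q (k + 1))
  have := Fintype.ofFinite (Transition Q (k + 1))
  let eP := Fintype.equivFin (Place Q (k + 1))
  let eT := Fintype.equivFin (Transition Q (k + 1))
  let init : ℕ → Marking (Place Q (k + 1)) := fun n p =>
    if p = .counter 0 false then n else if p = .ctrl (some q₀) then 1 else 0
  have hinit : ∀ n, Represents (init n) (some q₀, Pi.single 0 n) := by
    intro n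
    refine ⟨fun s => by simp [init], fun i => ?_, by simp [init]⟩
    by_cases hi : i = 0
    · subst hi
      simp [tokens, init]
    · simp [tokens, init, hi]
  let x : ℕ → ReachInput := fun n =>
    { htpn :=
        { places := _
          transitions := _
          net := (net μ (init n)).reindex eP eT
          transferOnly := (transferOnly_net μ (init n)).reindex eP eT }
      target := finalMarking ∘ eP.symm }
  refine ⟨x, ?_, fun n => ?_, fun n => ?_⟩
  · have h : Computable fun n => List.ofFn fun p => init n (eP.symm p) := by
      refine Computable.list_ofFn fun p => ?_
      simp only [init]
      split_ifs
      · exact Computable.id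
      · exact Computable.const 1
      · exact Computable.const 0
    rcases hc : (x 0).code with ⟨⟨a₁, a₂, a₃, a₄, a₅, _⟩, b⟩
    have hx : ∀ n, (x n).code =
        ((a₁, a₂, a₃, a₄, a₅, List.ofFn fun p => init n (eP.symm p)), b) := by
      intro n
      simp only [ReachInput.code, HTPN.code, Prod.mk.injEq] at hc ⊢
      obtain ⟨⟨h₁, h₂, h₃, h₄, h₅, -⟩, h₆⟩ := hc
      exact ⟨⟨h₁, h₂, h₃, h₄, h₅, rfl⟩, h₆⟩
    simp only [hx]
    exact ((Computable.const a₁).pair ((Computable.const a₂).pair ((Computable.const a₃).pair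
      ((Computable.const a₄).pair ((Computable.const a₅).pair h))))).pair (Computable.const b)
  · rw [← reachable_final_iff hk (hinit n)]
    refine ((net μ (init n)).reachable_reindex eP eT _).trans ?_
    rw [Function.comp_assoc, Equiv.symm_comp_self, Function.comp_id]
  · rw [← hasReachableDeadlock_iff hk (hinit n)]
    exact (net μ (init n)).hasReachableDeadlock_reindex eP eT

end PetriNets

theorem theorem5 :
    ¬ PetriNets.AlgorithmicallyDecidable PetriNets.ReachInput.code
        (fun x => x.htpn.net.Reachable x.target) ∧
    ¬ PetriNets.AlgorithmicallyDecidable PetriNets.HTPN.code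
        (fun N => N.net.HasReachableDeadlock) := by
  obtain ⟨p, hp⟩ := PetriNets.exists_undecidable_machine
  obtain ⟨x, hx, hreach, hdead⟩ := PetriNets.exists_computable_family p.machine p.first
  refine ⟨fun h => hp ?_, fun h => hp ?_⟩
  · exact (h.computablePred hx).of_eq hreach
  · exact (h.computablePred (r := fun n => (x n).htpn) (Computable.fst.comp hx)).of_eq hdead
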